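/- **Setting.** Let $f:\mathbb R^n\to\mathbb R$ be $\mathcal C^2$ with $L$-Lipschitz gradient, and let $g:\mathbb R^n\to\mathbb R\cup\{+\infty\}$ be proper and lower semi-continuous, such that $f+g$ is bounded below and, for every $\gamma>0$ and $y\in\mathbb R^n$, the set $\mathbf{prox}_{\gamma g}(y)=\operatorname{argmin}_u\{g(u)+\frac1{2\gamma}\|u-y\|^2\}$ is non-empty. Write $\partial g$ for the limiting subdifferential and $\widehat\partial g$ for the regular subdifferential. For a $\mathcal C^2$ submanifold $\mathcal M$ of $\mathbb R^n$, let $\operatorname{dist}_{\mathcal M}(x,y)$ be the infimum of the lengths of the $\mathcal C^2$ curves $[0,1]\to\mathcal M$ from $x$ to $y$ ($+\infty$ if there is none). *Structured critical points.* Let $r>0$. A point $\bar x$ of a $\mathcal C^2$ submanifold $\mathcal M$ is an $r$-structured critical point for $(f,g)$ if: (i) $\mathbf{prox}_{g/r}(\bar x-\frac1r\nabla f(\bar x))=\{\bar x\}$; (ii) $0\in\operatorname{ri}(\nabla f(\bar x)+\partial g(\bar x))$; (iii) $g$ is $r$-prox-regular at $\bar x$: $g$ is finite and locally lower semi-continuous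 at $\bar x$ and for every $\bar v\in\partial g(\bar x)$ there is $\varepsilon>0$ such that $g(x')\ge g(x)+\langle v,x'-x\rangle-\frac r2\|x'-x\|^2$ whenever $v\in\partial g(x)$, $\|x-\bar x\|<\varepsilon$, $\|x'-\bar x\|<\varepsilon$, $\|v-\bar v\|<\varepsilon$ and $g(x)<g(\bar x)+\varepsilon$; (iv) $g$ is partly smooth at $\bar x$ relative to $\mathcal M$: near $\bar x$, the restriction of $g$ to $\mathcal M$ is $\mathcal C^2$; $\widehat\partial g(x)=\partial g(x)\ne\emptyset$ at all $x\in\mathcal M$ near $\bar x$; the affine span of $\partial g(\bar x)$ is a translate of the normal space of $\mathcal M$ at $\bar x$; and $\partial g$ restricted to $\mathcal M$ is continuous at $\bar x$ as a set-valued mapping. *Algorithm.* Let $\mathrm{ManAcc}$ assign to a submanifold $\mathcal N$ an update map $\mathrm{ManAcc}_{\mathcal N}$. From an arbitrary $y_0$, a run with step $\gamma$ takes, for $k\ge1$, a point $x_k\in\mathbf{prox}_{\gamma g}(y_{k-1}-\gamma\nabla f(y_{k-1}))$ together with a $\mathcal C^2$ submanifold $\mathcal M_k\ni x_k$, and then $y_k=\mathrm{ManAcc}_{\mathcal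 M_k}(x_k)\in\mathcal M_k$. **Theorem.** Let $0<\gamma<1/L$ (any $\gamma>0$ if $L=0$), and let $(x_k),(y_k),(\mathcal M_k)$ be a run of the algorithm with step $\gamma$. Suppose that $(y_k)$ has a limit point $\bar x$ such that - i) $\bar x\in\mathcal M$ is an $r$-structured critical point for $(f,g)$ with $r<1/\gamma$, and the algorithm reports $\mathcal M$ near $\bar x$: there is a neighborhood $U$ of $\bar x$ such that $\mathcal M_k=\mathcal M$ for every $k\ge1$ with $x_k\in U\cap\mathcal M$; - ii) for some $\theta>0$, $\mathrm{ManAcc}_{\mathcal M}$ has superlinear convergence rate of order $1+\theta$ near $\bar x$ in $\mathcal M$: there are $\varepsilon,q>0$ such that $\operatorname{dist}_{\mathcal M}(\mathrm{ManAcc}_{\mathcal M}(x),\bar x)\le q\operatorname{dist}_{\mathcal M}(x,\bar x)^{1+\theta}$ for all $x\in\mathcal M$ with $\operatorname{dist}_{\mathcal M}(x,\bar x)<\varepsilon$. Then there is $K$ such that a) $x_k\in\mathcal M$ for all $k\ge K$; and b) $x_k\to\bar x$, in $\mathbb R^n$ and for $\operatorname{dist}_{\mathcal M}$, superlinearly with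 order $1+\theta$: $\operatorname{dist}_{\mathcal M}(x_k,\bar x)<\infty$ for all $k\ge K$, and for some $c>0$, $$\operatorname{dist}_{\mathcal M}(x_{k+1},\bar x)\le c\operatorname{dist}_{\mathcal M}(x_k,\bar x)^{1+\theta}\qquad\text{for all }k\ge K.$$ -/

import Mathlib

open Set Filter Topology
open scoped RealInnerProductSpace ENNReal NNReal

noncomputable section

/-! ### Submanifolds of a Euclidean space -/

section Submanifolds

variable {E : Type*} [NormedAddCommGroup E] [InnerProductSpace ℝ E]

/-- `M` is a `p`-dimensional `C²` submanifold around its point `x`: a neighborhood of `x` in `M` is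
the image of a neighborhood of `0 ∈ ℝᵖ` by a `C²` map `φ` with `φ 0 = x`, with injective derivative
at `0`, and with a `C²` local inverse `ψ`. -/
def IsC2SubmanifoldAt (p : ℕ) (M : Set E) (x : E) : Prop :=
  x ∈ M ∧ ∃ (φ : EuclideanSpace ℝ (Fin p) → E) (ψ : E → EuclideanSpace ℝ (Fin p))
    (U : Set (EuclideanSpace ℝ (Fin p))) (V : Set E),
    IsOpen U ∧ 0 ∈ U ∧ IsOpen V ∧ x ∈ V ∧
    φ 0 = x ∧ φ '' U = M ∩ V ∧
    ContDiffOn ℝ 2 φ U ∧ Function.Injective (fderiv ℝ φ 0) ∧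
    ContDiffOn ℝ 2 ψ V ∧ ∀ u ∈ U, ψ (φ u) = u

/-- `M` is a `C²` submanifold: it is one around each of its points. -/
def IsC2Submanifold (M : Set E) : Prop :=
  ∀ x ∈ M, ∃ p : ℕ, IsC2SubmanifoldAt p M x

/-- The tangent vectors of `M` at `x`: the velocities `c'(0)` of the `C²` curves `c` in `M`, defined
on an open interval around `0`, with `c(0) = x`. -/
def tangentVectors (M : Set E) (x : E) : Set E :=
  {w | ∃ (c : ℝ → E) (a : ℝ), 0 < a ∧ ContDiffOn ℝ 2 c (Ioo (-a) a) ∧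
    (∀ t ∈ Ioo (-a) a, c t ∈ M) ∧ c 0 = x ∧ deriv c 0 = w}

/-- The normal space of `M` at `x`: the vectors orthogonal to all the tangent vectors. -/
def normalSpace (M : Set E) (x : E) : Submodule ℝ E :=
  (Submodule.span ℝ (tangentVectors M x))ᗮ

/-- The Riemannian distance of `M` for the metric induced by the ambient space: the infimum of the
lengths of the `C²` curves `[0, 1] → M` from `x` to `y` (and `∞` if there is no such curve). -/
def riemannianDist (M : Set E) (x y : E) : ℝ≥0∞ :=
  ⨅ (c : ℝ → E) (_ : ContDiffOn ℝ 2 c (Icc 0 1) ∧ (∀ t ∈ Icc (0 : ℝ) 1, c t ∈ M) ∧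
      c 0 = x ∧ c 1 = y),
    ∫⁻ t in Icc (0 : ℝ) 1, ‖derivWithin c (Icc 0 1) t‖ₑ

end Submanifolds

/-! ### Variational analysis of functions with values in `ℝ ∪ {+∞}` -/

section Nonsmooth

variable {E : Type*} [NormedAddCommGroup E] [InnerProductSpace ℝ E]

/-- A proper function: never `-∞`, and not identically `+∞`. -/
def IsProperFun (g : E → EReal) : Prop :=
  (∀ x, g x ≠ ⊥) ∧ ∃ x, g x ≠ ⊤

/-- The regular subgradients of `g` at `x`: the vectors `v` such that
`g z ≥ g x + ⟪v, z - x⟫ + o(‖z - x‖)`, where `g x` is finite. -/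
def regularSubdifferential (g : E → EReal) (x : E) : Set E :=
  {v | g x ≠ ⊤ ∧ g x ≠ ⊥ ∧ ∀ ε : ℝ, 0 < ε →
    ∀ᶠ z in 𝓝 x, g x + ((⟪v, z - x⟫ - ε * ‖z - x‖ : ℝ) : EReal) ≤ g z}

/-- The (general, or limiting) subgradients of `g` at `x`, where `g x` is finite. -/
def limitingSubdifferential (g : E → EReal) (x : E) : Set E :=
  {v | g x ≠ ⊤ ∧ g x ≠ ⊥ ∧ ∃ (xs vs : ℕ → E),
    Tendsto xs atTop (𝓝 x) ∧ Tendsto (fun k => g (xs k)) atTop (𝓝 (g x)) ∧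
    (∀ k, vs k ∈ regularSubdifferential g (xs k)) ∧ Tendsto vs atTop (𝓝 v)}

/-- The proximity operator (set-valued): the minimizers of `u ↦ g u + ‖u - y‖² / (2γ)`. -/
def proxSet (γ : ℝ) (g : E → EReal) (y : E) : Set E :=
  {u | ∀ w, g u + ((1 / (2 * γ) * ‖u - y‖ ^ 2 : ℝ) : EReal)
    ≤ g w + ((1 / (2 * γ) * ‖w - y‖ ^ 2 : ℝ) : EReal)}

/-- `g` is locally lower semi-continuous at `x`: some localization of its epigraph around
`(x, g x)` is closed. -/
def IsLocallyLscAt (g : E → EReal) (x : E) : Prop :=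
  ∃ ε : ℝ, 0 < ε ∧ ∀ α : ℝ, (α : EReal) ≤ g x + (ε : EReal) →
    IsClosed {z | z ∈ Metric.closedBall x ε ∧ g z ≤ (α : EReal)}

/-- `g` is prox-regular at `x` for the subgradient `v`, with constant `r`. -/
def IsProxRegularAtFor (r : ℝ) (g : E → EReal) (x v : E) : Prop :=
  g x ≠ ⊤ ∧ g x ≠ ⊥ ∧ IsLocallyLscAt g x ∧ ∃ ε : ℝ, 0 < ε ∧
    ∀ z z' w : E, w ∈ limitingSubdifferential g z → ‖z - x‖ < ε → ‖z' - x‖ < ε →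
      ‖w - v‖ < ε → g z < g x + (ε : EReal) →
      g z + ((⟪w, z' - z⟫ - r / 2 * ‖z' - z‖ ^ 2 : ℝ) : EReal) ≤ g z'

/-- `g` is `r`-prox-regular at `x`: it is so for all its subgradients at `x`. -/
def IsProxRegularAt (r : ℝ) (g : E → EReal) (x : E) : Prop :=
  ∀ v ∈ limitingSubdifferential g x, IsProxRegularAtFor r g x v

/-- The set-valued mapping `S`, restricted to `M`, is continuous at `x`: it is outer and inner
semi-continuous there, in the sense of Painlevé and Kuratowski. -/
def IsSetContinuousWithinAt (S : E → Set E) (M : Set E) (x : E) : Prop :=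
  (∀ (xs vs : ℕ → E) (v : E), (∀ k, xs k ∈ M) → Tendsto xs atTop (𝓝 x) →
    (∀ k, vs k ∈ S (xs k)) → Tendsto vs atTop (𝓝 v) → v ∈ S x) ∧
  (∀ v ∈ S x, ∀ xs : ℕ → E, (∀ k, xs k ∈ M) → Tendsto xs atTop (𝓝 x) →
    ∃ vs : ℕ → E, (∀ᶠ k in atTop, vs k ∈ S (xs k)) ∧ Tendsto vs atTop (𝓝 v))

/-- `g` is (`C²`-)partly smooth at `x` relative to `M`. -/
structure IsPartlySmoothAt (g : E → EReal) (M : Set E) (x : E) : Prop where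
  /-- `M` is a `C²` manifold around its point `x` -/
  manifold : ∃ p : ℕ, IsC2SubmanifoldAt p M x
  /-- the restriction of `g` to `M` is `C²` near `x`, that is, it has a `C²` local extension -/
  smoothness : ∃ h : E → ℝ, ContDiffAt ℝ 2 h x ∧ ∀ᶠ z in 𝓝[M] x, g z = (h z : EReal)
  /-- `g` is regular, with a subgradient, at all points of `M` near `x` -/
  regularity : ∀ᶠ z in 𝓝[M] x, regularSubdifferential g z = limitingSubdifferential g z ∧
    (limitingSubdifferential g z).Nonempty
  /-- the affine span of the subdifferential at `x` is a translate of the normal space -/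
  sharpness : ∃ a : E,
    affineSpan ℝ (limitingSubdifferential g x) = AffineSubspace.mk' a (normalSpace M x)
  /-- the subdifferential, restricted to `M`, is continuous at `x` -/
  subcontinuity : IsSetContinuousWithinAt (limitingSubdifferential g) M x

variable [CompleteSpace E]

/-- `x` is an `r`-structured critical point, on the `C²` submanifold `M`, for `(f, g)`. -/
structure IsStructuredCriticalPoint (r : ℝ) (f : E → ℝ) (g : E → EReal) (M : Set E) (x : E) :
    Prop where
  pos : 0 < r
  submanifold : IsC2Submanifold M
  mem : x ∈ M
  /-- proximal gradient stability -/
  stability : proxSet (1 / r) g (x - (1 / r) • gradient f x) = {x}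
  /-- qualification: `0` is in the relative interior of `∇f(x) + ∂g(x)` -/
  qualification :
    0 ∈ intrinsicInterior ℝ ((fun v => gradient f x + v) '' limitingSubdifferential g x)
  proxRegular : IsProxRegularAt r g x
  partlySmooth : IsPartlySmoothAt g M x

/-- The blanket assumptions on the problem `min f + g`. -/
structure BlanketAssumptions (f : E → ℝ) (g : E → EReal) (L : ℝ≥0) : Prop where
  proper : IsProperFun g
  contDiff : ContDiff ℝ 2 f
  lipschitz : LipschitzWith L (gradient f)
  lsc : LowerSemicontinuous g
  prox_nonempty : ∀ γ : ℝ, 0 < γ → ∀ y, (proxSet γ g y).Nonempty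
  bddBelow : ∃ m : ℝ, ∀ x, (m : EReal) ≤ (f x : EReal) + g x

end Nonsmooth

/-! ### The algorithm -/

section Algorithm

variable {E : Type*} [NormedAddCommGroup E] [InnerProductSpace ℝ E]

/-- `x`, `y`, `N` are the points and manifolds of a run of the general algorithm with step `γ` and
manifold update `ManAcc`, started at an arbitrary `y 0`: for `k ≥ 1`, `x k` is obtained from
`y (k - 1)` by a proximal gradient step, it comes with a submanifold `N k ∋ x k`, and
`y k = ManAcc (N k) (x k)` is a point of `N k`. -/
structure IsAlgorithmRun [CompleteSpace E] (f : E → ℝ) (g : E → EReal) (γ : ℝ)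
    (ManAcc : Set E → E → E) (x y : ℕ → E) (N : ℕ → Set E) : Prop where
  prox_step : ∀ k, x (k + 1) ∈ proxSet γ g (y k - γ • gradient f (y k))
  submanifold : ∀ k, IsC2Submanifold (N (k + 1))
  mem : ∀ k, x (k + 1) ∈ N (k + 1)
  update : ∀ k, y (k + 1) = ManAcc (N (k + 1)) (x (k + 1))
  update_mem : ∀ k, y (k + 1) ∈ N (k + 1)

/-- `M` is the manifold which the algorithm reports near `z`: whenever an iterate `x k` (`k ≥ 1`)
close enough to `z` lies on `M`, the manifold `N k` that comes with it is `M`. -/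
def ReportsManifoldNear (x : ℕ → E) (N : ℕ → Set E) (M : Set E) (z : E) : Prop :=
  ∃ U ∈ 𝓝 z, ∀ k, x (k + 1) ∈ U → x (k + 1) ∈ M → N (k + 1) = M

/-- The update `T` of the manifold `M` has a superlinear convergence rate of order `p` near `z`
in `M`. -/
def HasLocalRate (T : E → E) (M : Set E) (z : E) (p : ℝ) : Prop :=
  ∃ ε : ℝ, 0 < ε ∧ ∃ q : ℝ, 0 < q ∧ ∀ x ∈ M, riemannianDist M x z < ENNReal.ofReal ε →
    riemannianDist M (T x) z ≤ ENNReal.ofReal q * riemannianDist M x z ^ p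

end Algorithm

end

/-! ### Geometry of submanifolds: distance comparison and local projection. -/

section Geometry

variable {E : Type*} [NormedAddCommGroup E] [InnerProductSpace ℝ E]

/-! Near the critical point `xbar`, a proximal gradient step returns to `M` and loses at most a
constant factor in distance; the superlinear manifold update then more than compensates for this
factor.

Stability at parameter `1 / r` makes `-∇f(xbar)` a global subgradient of `g` at `xbar` up to the
error `r/2 ‖·‖²`. Since `r < 1/γ`, the strong convexity of the proximal term dominates this error,
so every output of the step satisfies `‖w - xbar‖ ≤ A ‖y - xbar‖` (`norm_prox_sub_le`), although `g`
is nonconvex and its prox multivalued.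

Membership in `M` (`eventually_proxSet_subset`) is by contradiction. If prox points off `M`
converged to `xbar`, their normalized residuals from a projection on `M` would have a unit normal
limit `n`. Qualification and sharpness allow tilting the subgradient to `v + ε n`; inner
semicontinuity carries it to nearby points of `M`, and prox-regularity together with prox optimality
then gives `ε ≤ 0` in the limit.

On `M` near `xbar` the Riemannian and ambient distances are comparable, so the rate of the update
combines with the linear bound. A single visit of `y` close enough to `xbar` starts a contraction,
and the rate for `x` follows by composing the two bounds. -/

theorem enorm_sub_le_riemannianDist [CompleteSpace E] (M : Set E) (x y : E) :
    ‖x - y‖ₑ ≤ riemannianDist M x y := by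
  refine le_iInf₂ fun c hc => ?_
  obtain ⟨hc, -, rfl, rfl⟩ := hc
  rw [← enorm_neg, neg_sub]
  exact enorm_sub_le_lintegral_derivWithin_Icc_of_contDiffOn_Icc (hc.of_le one_le_two)
    zero_le_one

/-- The image under `φ` of the straight segment from `ψ z` to `0` is an admissible curve, of length
at most `Lip φ · ‖ψ z‖ ≤ Lip φ · Lip ψ · ‖z - x‖`. -/
theorem IsC2SubmanifoldAt.exists_riemannianDist_le {p : ℕ} {M : Set E} {x : E}
    (hM : IsC2SubmanifoldAt p M x) :
    ∃ C : ℝ, 0 < C ∧ ∀ᶠ z in 𝓝[M] x, riemannianDist M z x ≤ ENNReal.ofReal (C * ‖z - x‖) := by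
  obtain ⟨-, φ, ψ, U, V, hU, h0U, hV, hxV, hφ0, hφU, hφ, -, hψ, hinv⟩ := hM
  have hφ1 : ContDiffAt ℝ 1 φ 0 := (hφ.contDiffAt (hU.mem_nhds h0U)).of_le one_le_two
  have hψ1 : ContDiffAt ℝ 1 ψ x := (hψ.contDiffAt (hV.mem_nhds hxV)).of_le one_le_two
  have hψx : ψ x = 0 := by rw [← hφ0, hinv 0 h0U]
  obtain ⟨A, s, hs, hA⟩ := hφ1.exists_lipschitzOnWith
  obtain ⟨B, W, hW, hB⟩ := hψ1.exists_lipschitzOnWith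
  obtain ⟨ρ, hρ, hρs⟩ := Metric.mem_nhds_iff.1 (inter_mem hs (hU.mem_nhds h0U))
  refine ⟨A * B + 1, by positivity, ?_⟩
  have hball : ∀ᶠ z in 𝓝[M] x, ψ z ∈ Metric.ball 0 ρ := by
    have := hψ1.continuousAt.tendsto
    rw [hψx] at this
    exact nhdsWithin_le_nhds (this (Metric.ball_mem_nhds _ hρ))
  filter_upwards [self_mem_nhdsWithin, nhdsWithin_le_nhds hW,
    nhdsWithin_le_nhds (hV.mem_nhds hxV), hball] with z hzM hzW hzV hzb
  obtain ⟨u, huU, hu⟩ : z ∈ φ '' U := hφU ▸ ⟨hzM, hzV⟩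
  have huz : ψ z = u := by rw [← hu, hinv u huU]
  rw [huz] at hzb
  have hseg : ∀ t ∈ Icc (0 : ℝ) 1, (1 - t) • u ∈ Metric.ball (0 : EuclideanSpace ℝ (Fin p)) ρ := by
    intro t ht
    rw [mem_ball_zero_iff] at hzb ⊢
    rw [norm_smul, Real.norm_of_nonneg (by linarith [ht.2])]
    nlinarith [norm_nonneg u, ht.1]
  have hucb : ‖u‖ ≤ B * ‖z - x‖ := by
    have := hB.dist_le_mul z hzW x (mem_of_mem_nhds hW)
    rwa [huz, hψx, dist_zero_right, dist_eq_norm] at this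
  have hcd : ContDiffOn ℝ 2 (fun t : ℝ => φ ((1 - t) • u)) (Icc 0 1) := by
    refine hφ.comp (s := Icc (0 : ℝ) 1) (g := φ) (f := fun t : ℝ => (1 - t) • u) ?_ ?_
    · fun_prop
    · exact fun t ht => (hρs (hseg t ht)).2
  have hlip : LipschitzOnWith (A * ‖u‖₊) (fun t : ℝ => φ ((1 - t) • u)) (Icc 0 1) := by
    refine LipschitzOnWith.of_dist_le_mul fun t ht t' ht' => ?_
    refine (hA.dist_le_mul _ (hρs (hseg t ht)).1 _ (hρs (hseg t' ht')).1).trans ?_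
    rw [dist_eq_norm, ← sub_smul, norm_smul, dist_eq_norm]
    have : ‖1 - t - (1 - t')‖ = ‖t - t'‖ := by rw [← norm_neg]; congr 1; ring
    rw [this]
    push_cast
    exact le_of_eq (by ring)
  calc riemannianDist M z x
      ≤ ∫⁻ t in Icc (0 : ℝ) 1, ‖derivWithin (fun t : ℝ => φ ((1 - t) • u)) (Icc 0 1) t‖ₑ := by
        refine iInf₂_le _ ⟨hcd, fun t ht => ?_, by simpa using hu, by simpa using hφ0⟩
        have : φ ((1 - t) • u) ∈ φ '' U := mem_image_of_mem _ (hρs (hseg t ht)).2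
        rw [hφU] at this
        exact this.1
    _ ≤ ∫⁻ _ in Icc (0 : ℝ) 1, ((A * ‖u‖₊ : ℝ≥0) : ℝ≥0∞) := by
        rw [← MeasureTheory.restrict_Ioo_eq_restrict_Icc]
        refine MeasureTheory.setLIntegral_mono measurable_const fun t ht => ?_
        have hIcc := Icc_mem_nhds ht.1 ht.2
        rw [enorm_eq_nnnorm, ENNReal.coe_le_coe, ← NNReal.coe_le_coe, coe_nnnorm,
          derivWithin_of_mem_nhds hIcc]
        exact norm_deriv_le_of_lipschitzOn hIcc hlip
    _ = ((A * ‖u‖₊ : ℝ≥0) : ℝ≥0∞) := by simp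
    _ ≤ ENNReal.ofReal ((A * B + 1) * ‖z - x‖) := by
        rw [← ENNReal.ofReal_coe_nnreal]
        refine ENNReal.ofReal_le_ofReal ?_
        push_cast
        nlinarith [norm_nonneg (z - x), mul_le_mul_of_nonneg_left hucb A.coe_nonneg]

/-- A local projection on a submanifold: the normalized residuals are asymptotically orthogonal to
the tangent vectors. -/
theorem IsC2SubmanifoldAt.exists_projection {p : ℕ} {M : Set E} {x : E}
    (hM : IsC2SubmanifoldAt p M x) :
    ∃ P : E → E, (∀ w, P w ∈ M) ∧ Tendsto P (𝓝 x) (𝓝 x) ∧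
      ∀ τ ∈ tangentVectors M x,
        Tendsto (fun w => ⟪‖w - P w‖⁻¹ • (w - P w), τ⟫) (𝓝 x) (𝓝 0) := by
  obtain ⟨-, φ, ψ, U, V, hU, h0U, hV, hxV, hφ0, hφU, hφ, -, hψ, hinv⟩ := hM
  have hψ1 : ContDiffAt ℝ 1 ψ x := (hψ.contDiffAt (hV.mem_nhds hxV)).of_le one_le_two
  have hψx : ψ x = 0 := by rw [← hφ0, hinv 0 h0U]
  obtain ⟨ρ, hρ, hρU⟩ := Metric.nhds_basis_closedBall.mem_iff.1 (hU.mem_nhds h0U)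
  -- `P w` will be a nearest point to `w` in this compact piece of `M`.
  have hcomp : IsCompact (φ '' Metric.closedBall 0 ρ) :=
    (isCompact_closedBall _ _).image_of_continuousOn (hφ.continuousOn.mono hρU)
  have hxK : x ∈ φ '' Metric.closedBall 0 ρ := ⟨0, by simp [hρ.le], hφ0⟩
  have hex : ∀ w, ∃ t ∈ Metric.closedBall (0 : EuclideanSpace ℝ (Fin p)) ρ,
      Metric.infDist w (φ '' Metric.closedBall 0 ρ) = dist w (φ t) := by
    intro w
    obtain ⟨_, ⟨t, ht, rfl⟩, h⟩ := hcomp.exists_infDist_eq_dist ⟨x, hxK⟩ w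
    exact ⟨t, ht, h⟩
  choose t ht htd using hex
  have hmin : ∀ w, ∀ s ∈ Metric.closedBall (0 : EuclideanSpace ℝ (Fin p)) ρ,
      ‖w - φ (t w)‖ ≤ ‖w - φ s‖ := by
    intro w s hs
    rw [← dist_eq_norm, ← dist_eq_norm, ← htd w]
    exact Metric.infDist_le_dist_of_mem (mem_image_of_mem _ hs)
  have hP : Tendsto (fun w => φ (t w)) (𝓝 x) (𝓝 x) := by
    have h2 : Tendsto (fun w => 2 * ‖w - x‖) (𝓝 x) (𝓝 0) := by
      have : Continuous fun w => 2 * ‖w - x‖ := by fun_prop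
      simpa using this.tendsto x
    rw [tendsto_iff_norm_sub_tendsto_zero]
    refine squeeze_zero (fun _ => norm_nonneg _) (fun w => ?_) h2
    have h1 := hmin w 0 (by simp [hρ.le])
    rw [hφ0] at h1
    have h3 := norm_sub_le (w - x) (w - φ (t w))
    rw [sub_sub_sub_cancel_left] at h3
    linarith
  have ht0 : Tendsto t (𝓝 x) (𝓝 0) := by
    have := hψ1.continuousAt.tendsto.comp hP
    rw [hψx] at this
    refine this.congr fun w => ?_
    exact hinv _ (hρU (ht w))
  refine ⟨fun w => φ (t w), fun w => ?_, hP, ?_⟩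
  · have : φ (t w) ∈ φ '' U := mem_image_of_mem _ (hρU (ht w))
    rw [hφU] at this
    exact this.1
  rintro τ ⟨c, a, ha, hc, hcM, hc0, rfl⟩
  have h0a : Ioo (-a) a ∈ 𝓝 (0 : ℝ) := Ioo_mem_nhds (by linarith) ha
  have hcd : DifferentiableAt ℝ c 0 := (hc.contDiffAt h0a).differentiableAt two_ne_zero
  have hψd : DifferentiableAt ℝ ψ (c 0) := by
    rw [hc0]; exact hψ1.differentiableAt one_ne_zero
  have hφd : ∀ u ∈ U, DifferentiableAt ℝ φ u := fun u hu =>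
    (hφ.contDiffAt (hU.mem_nhds hu)).differentiableAt two_ne_zero
  have hψc := (hψd.hasFDerivAt.comp_hasDerivAt 0 hcd.hasDerivAt)
  have hφψc : HasDerivAt (φ ∘ (ψ ∘ c)) (fderiv ℝ φ 0 (fderiv ℝ ψ (c 0) (deriv c 0))) 0 := by
    have h := hφd 0 h0U
    have h' : (ψ ∘ c) 0 = 0 := by simp [hc0, hψx]
    rw [← h'] at h ⊢
    exact h.hasFDerivAt.comp_hasDerivAt _ hψc
  -- Reading the curve in the chart shows that its velocity lies in the range of `Dφ(0)`.
  have hev : φ ∘ (ψ ∘ c) =ᶠ[𝓝 0] c := by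
    have hcV : ∀ᶠ s in 𝓝 (0 : ℝ), c s ∈ V :=
      hcd.continuousAt.tendsto (by rw [hc0]; exact hV.mem_nhds hxV)
    filter_upwards [h0a, hcV] with s hs hsV
    obtain ⟨u, huU, hu⟩ : c s ∈ φ '' U := hφU ▸ ⟨hcM s hs, hsV⟩
    simp only [Function.comp_apply, ← hu, hinv u huU]
  have hderiv : deriv c 0 = fderiv ℝ φ 0 (fderiv ℝ ψ (c 0) (deriv c 0)) :=
    (hφψc.congr_of_eventuallyEq hev.symm).deriv
  set s := fderiv ℝ ψ (c 0) (deriv c 0)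
  rw [hderiv]
  -- First-order optimality: for `w` near `x`, the minimizer `t w` is interior to the ball.
  have horth : ∀ᶠ w in 𝓝 x, ⟪w - φ (t w), fderiv ℝ φ (t w) s⟫ = 0 := by
    filter_upwards [ht0 (Metric.ball_mem_nhds _ hρ)] with w hw
    have hloc : IsLocalMin (fun u => ‖w - φ u‖ ^ 2) (t w) := by
      filter_upwards [Metric.isOpen_ball.mem_nhds hw] with u hu
      gcongr
      exact hmin w u (Metric.ball_subset_closedBall hu)
    have hd := ((hφd _ (hρU (ht w))).hasFDerivAt.const_sub w).norm_sq
    have := DFunLike.congr_fun (hloc.hasFDerivAt_eq_zero hd) s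
    rw [inner_sub_left]
    simp at this
    linarith
  -- Orthogonality holds for `Dφ(t w) s`, not `Dφ(0) s`; the discrepancy vanishes by continuity of
  -- `Dφ`.
  have hDφ : Tendsto (fun w => ‖(fderiv ℝ φ 0 - fderiv ℝ φ (t w)) s‖) (𝓝 x) (𝓝 0) := by
    have hcont : ContinuousAt (fderiv ℝ φ) 0 :=
      ((hφ.contDiffAt (hU.mem_nhds h0U)).fderiv_right (m := 1) (by norm_num)).continuousAt
    have h1 := hcont.tendsto.comp ht0
    have h2 := ((ContinuousLinearMap.apply ℝ E s).continuous.tendsto _).comp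
      ((tendsto_const_nhds (x := fderiv ℝ φ 0)).sub h1)
    simpa using h2.norm
  refine squeeze_zero_norm' ?_ hDφ
  filter_upwards [horth] with w hw
  have : ⟪‖w - φ (t w)‖⁻¹ • (w - φ (t w)), fderiv ℝ φ 0 s⟫ =
      ⟪‖w - φ (t w)‖⁻¹ • (w - φ (t w)), (fderiv ℝ φ 0 - fderiv ℝ φ (t w)) s⟫ := by
    rw [sub_apply, inner_sub_right, real_inner_smul_left _ (fderiv ℝ φ (t w) s),
      hw, mul_zero, sub_zero]
  rw [this]
  refine (norm_inner_le_norm _ _).trans ?_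
  refine mul_le_of_le_one_left (norm_nonneg _) ?_
  rw [norm_smul, norm_inv, norm_norm]
  exact inv_mul_le_one

end Geometry

/-! ### Stability of the proximity operator and identification of the manifold. -/

section Identification

theorem exists_coe_eq_of_mem_proxSet {E : Type*} [NormedAddCommGroup E] {g : E → EReal} (hg : IsProperFun g) {γ : ℝ} {u z : E}
    (hu : u ∈ proxSet γ g z) : ∃ a : ℝ, g u = (a : EReal) := by
  obtain ⟨w, hw⟩ := hg.2
  have h := hu w
  lift g w to ℝ using ⟨hw, hg.1 w⟩ with b
  refine ⟨(g u).toReal, (EReal.coe_toReal (fun htop => ?_) (hg.1 u)).symm⟩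
  rw [htop, EReal.top_add_coe, ← EReal.coe_add] at h
  exact EReal.coe_ne_top _ (top_le_iff.1 h)

variable {E : Type*} [NormedAddCommGroup E] [InnerProductSpace ℝ E]

/-- Expanding the squares in the optimality of `u` shows that `γ⁻¹ • (z - u)` is a global
subgradient at `u` up to a quadratic error. -/
theorem le_of_mem_proxSet {g : E → EReal} {γ : ℝ} (hγ : 0 < γ) {u z w : E} {a b : ℝ}
    (hu : u ∈ proxSet γ g z) (ha : g u = (a : EReal)) (hb : g w = (b : EReal)) :
    a + ⟪γ⁻¹ • (z - u), w - u⟫ - γ⁻¹ / 2 * ‖w - u‖ ^ 2 ≤ b := by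
  have h := hu w
  rw [ha, hb, ← EReal.coe_add, ← EReal.coe_add, EReal.coe_le_coe_iff] at h
  have h1 : ‖w - z‖ ^ 2 = ‖w - u‖ ^ 2 - 2 * ⟪z - u, w - u⟫ + ‖u - z‖ ^ 2 := by
    rw [← sub_sub_sub_cancel_right w z u, norm_sub_sq_real, real_inner_comm, norm_sub_rev z u]
  have h2 : 1 / (2 * γ) = γ⁻¹ / 2 := by field_simp
  rw [h1, h2] at h
  rw [real_inner_smul_left]
  linarith

/-- `v` is a subgradient of `g` at `x` with a quadratic error term, globally. -/
def HasGlobalQuadraticMinorant (r : ℝ) (g : E → EReal) (x v : E) : Prop :=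
  ∃ a : ℝ, g x = (a : EReal) ∧
    ∀ u : E, ∀ b : ℝ, g u = (b : EReal) → a + ⟪v, u - x⟫ - r / 2 * ‖u - x‖ ^ 2 ≤ b

/-- Adding the minorant at `x` tested at `w` to the prox optimality of `w` tested at `x` cancels the
values of `g` and leaves `(1 - rγ) ‖w - x‖² ≤ 2 ‖z - (x + γ v)‖ ‖w - x‖`. -/
theorem HasGlobalQuadraticMinorant.norm_prox_sub_le {r : ℝ} {g : E → EReal} {x v : E}
    (h : HasGlobalQuadraticMinorant r g x v) (hg : IsProperFun g) {γ : ℝ} (hγ : 0 < γ)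
    (hr : r < 1 / γ) {w z : E} (hw : w ∈ proxSet γ g z) :
    ‖w - x‖ ≤ 2 / (1 - r * γ) * ‖z - (x + γ • v)‖ := by
  obtain ⟨a, ha, hmin⟩ := h
  obtain ⟨b, hb⟩ := exists_coe_eq_of_mem_proxSet hg hw
  have h1 := hmin w b hb
  have h2 := le_of_mem_proxSet hγ hw hb ha
  have hrγ : 0 < 1 - r * γ := by
    rw [lt_div_iff₀ hγ] at hr; linarith
  have e1 : γ⁻¹ • (z - w) = γ⁻¹ • (z - (x + γ • v)) + v - γ⁻¹ • (w - x) := by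
    have : v = γ⁻¹ • γ • v := by rw [smul_smul, inv_mul_cancel₀ hγ.ne', one_smul]
    nth_rw 2 [this]
    rw [← smul_add, ← smul_sub]
    congr 1
    abel
  rw [e1, ← neg_sub w x, inner_neg_right, inner_sub_left, inner_add_left, real_inner_smul_left,
    real_inner_smul_left, real_inner_self_eq_norm_sq, norm_neg] at h2
  have h3 := real_inner_le_norm (z - (x + γ • v)) (w - x)
  set d := ‖w - x‖
  set e := ‖z - (x + γ • v)‖
  have h4 : γ⁻¹ * d ^ 2 ≤ γ⁻¹ * (e * d) + (r / 2 + γ⁻¹ / 2) * d ^ 2 := by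
    have := mul_le_mul_of_nonneg_left h3 (inv_pos.2 hγ).le
    linarith
  have h5 : (1 - r * γ) * d * d ≤ 2 * e * d := by
    have := mul_le_mul_of_nonneg_left h4 hγ.le
    field_simp at this
    linarith
  rw [div_mul_eq_mul_div, le_div_iff₀ hrγ]
  rcases (norm_nonneg (w - x)).eq_or_lt with hd | hd
  · rw [show d = 0 from hd.symm, zero_mul]; positivity
  · have := le_of_mul_le_mul_right h5 hd
    linarith

/-- This extracts from proximal stability a global inequality, which the local notion of
prox-regularity cannot supply. -/
theorem hasGlobalQuadraticMinorant_of_mem_proxSet {r : ℝ} (hr : 0 < r) {g : E → EReal}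
    (hg : IsProperFun g) {x v : E} (h : x ∈ proxSet (1 / r) g (x + (1 / r) • v)) :
    HasGlobalQuadraticMinorant r g x v := by
  obtain ⟨a, ha⟩ := exists_coe_eq_of_mem_proxSet hg h
  refine ⟨a, ha, fun u b hb => ?_⟩
  have := le_of_mem_proxSet (one_div_pos.2 hr) h ha hb
  rwa [add_sub_cancel_left, smul_smul, inv_mul_cancel₀ (one_div_pos.2 hr).ne', one_smul, one_div,
    inv_inv] at this

/-- A point of the relative interior can be moved along the direction of the affine span. -/
theorem exists_add_smul_mem_of_mem_intrinsicInterior {S : Set E} {v n : E}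
    (hv : v ∈ intrinsicInterior ℝ S) (hn : n ∈ (affineSpan ℝ S).direction) :
    ∃ ε : ℝ, 0 < ε ∧ v + ε • n ∈ S := by
  obtain ⟨v', hv', rfl⟩ := mem_intrinsicInterior.1 hv
  have hmem : ∀ t : ℝ, (v' : E) + t • n ∈ affineSpan ℝ S := fun t => by
    rw [add_comm]
    exact AffineSubspace.vadd_mem_of_mem_direction (Submodule.smul_mem _ t hn) v'.2
  let c : ℝ → affineSpan ℝ S := fun t => ⟨v' + t • n, hmem t⟩
  have hc : Continuous c := by
    refine Continuous.subtype_mk ?_ _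
    fun_prop
  have hc0 : c 0 = v' := by ext; simp [c]
  have hnhds : ∀ᶠ t in 𝓝[>] (0 : ℝ), c t ∈ ((↑) ⁻¹' S : Set (affineSpan ℝ S)) := by
    refine nhdsWithin_le_nhds (hc.tendsto 0 ?_)
    rw [hc0]
    exact mem_interior_iff_mem_nhds.1 hv'
  obtain ⟨t, ht, ht0⟩ := (hnhds.and self_mem_nhdsWithin).exists
  exact ⟨t, ht0, ht⟩

theorem mem_intrinsicInterior_of_zero_mem_image_add {S : Set E} {a : E}
    (h : 0 ∈ intrinsicInterior ℝ ((fun v => a + v) '' S)) : -a ∈ intrinsicInterior ℝ S := by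
  have : (fun v => a + v) '' S = (AffineIsometryEquiv.constVAdd ℝ E a).toAffineIsometry '' S := by
    ext; simp
  rw [this, AffineIsometry.intrinsicInterior_image] at h
  obtain ⟨v, hv, hav⟩ := h
  have : v = -a := by
    simp at hav
    exact (neg_eq_of_add_eq_zero_right hav).symm
  rwa [← this]

theorem mem_normalSpace_iff {M : Set E} {x n : E} :
    n ∈ normalSpace M x ↔ ∀ τ ∈ tangentVectors M x, ⟪n, τ⟫ = 0 := by
  rw [normalSpace, Submodule.mem_orthogonal']
  refine ⟨fun h τ hτ => h τ (Submodule.subset_span hτ), fun h τ hτ => ?_⟩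
  have : Submodule.span ℝ (tangentVectors M x) ≤ (LinearMap.ker (innerSL ℝ n).toLinearMap) :=
    Submodule.span_le.2 fun τ hτ => by simpa using h τ hτ
  simpa using this hτ

/-- Finite identification of the active manifold by the proximity operator. -/
theorem eventually_proxSet_subset [FiniteDimensional ℝ E] {r : ℝ} {g : E → EReal} {M : Set E}
    {x v : E} (hg : IsProperFun g) (hps : IsPartlySmoothAt g M x) (hpr : IsProxRegularAt r g x)
    (hv : v ∈ intrinsicInterior ℝ (limitingSubdifferential g x))
    (hmin : HasGlobalQuadraticMinorant r g x v) {γ : ℝ} (hγ : 0 < γ) (hr : r < 1 / γ) :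
    ∀ᶠ z in 𝓝 (x + γ • v), proxSet γ g z ⊆ M := by
  by_contra hcon
  obtain ⟨zs₀, hzs₀, hbad⟩ := exists_seq_forall_of_frequently (not_eventually.1 hcon)
  simp only [not_subset] at hbad
  choose ws₀ hws₀ hwM₀ using hbad
  have hws₀x : Tendsto ws₀ atTop (𝓝 x) := by
    rw [tendsto_iff_norm_sub_tendsto_zero] at hzs₀ ⊢
    refine squeeze_zero (fun _ => norm_nonneg _)
      (fun k => hmin.norm_prox_sub_le hg hγ hr (hws₀ k)) ?_
    simpa using hzs₀.const_mul (2 / (1 - r * γ))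
  obtain ⟨p, hM⟩ := hps.manifold
  obtain ⟨P, hPM, hPx, hPτ⟩ := hM.exists_projection
  have hsph : ∀ k, ‖ws₀ k - P (ws₀ k)‖⁻¹ • (ws₀ k - P (ws₀ k)) ∈ Metric.sphere (0 : E) 1 := by
    intro k
    have hne : ‖ws₀ k - P (ws₀ k)‖ ≠ 0 := fun h0 =>
      hwM₀ k (sub_eq_zero.1 (norm_eq_zero.1 h0) ▸ hPM _)
    rw [mem_sphere_zero_iff_norm, norm_smul, norm_inv, norm_norm, inv_mul_cancel₀ hne]
  obtain ⟨n, hn, σ, hσ, hlim⟩ := (isCompact_sphere (0 : E) 1).tendsto_subseq hsph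
  have hzs := hzs₀.comp hσ.tendsto_atTop
  have hwsx := hws₀x.comp hσ.tendsto_atTop
  have hws : ∀ k, (ws₀ ∘ σ) k ∈ proxSet γ g ((zs₀ ∘ σ) k) := fun k => hws₀ (σ k)
  have hlim' : Tendsto (fun k => ‖(ws₀ ∘ σ) k - P ((ws₀ ∘ σ) k)‖⁻¹ •
    ((ws₀ ∘ σ) k - P ((ws₀ ∘ σ) k))) atTop (𝓝 n) := hlim
  have hsph' : ∀ k, (ws₀ ∘ σ) k ∉ M := fun k => hwM₀ (σ k)
  generalize ws₀ ∘ σ = ws at *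
  generalize zs₀ ∘ σ = zs at *
  have hnN : n ∈ normalSpace M x := mem_normalSpace_iff.2 fun τ hτ =>
    tendsto_nhds_unique (hlim'.inner tendsto_const_nhds) ((hPτ τ hτ).comp hwsx)
  obtain ⟨a, haff⟩ := hps.sharpness
  -- By sharpness, the direction of the affine span of the subdifferential is the normal space,
  -- which contains `n`.
  obtain ⟨ε, hε, hu⟩ := exists_add_smul_mem_of_mem_intrinsicInterior hv
    (n := n) (by rwa [haff, AffineSubspace.direction_mk'])
  have hpx : Tendsto (fun k => P (ws k)) atTop (𝓝 x) := hPx.comp hwsx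
  have hpxM : Tendsto (fun k => P (ws k)) atTop (𝓝[M] x) :=
    tendsto_nhdsWithin_iff.2 ⟨hpx, Eventually.of_forall fun k => hPM _⟩
  obtain ⟨us, hus, husx⟩ := hps.subcontinuity.2 _ hu (fun k => P (ws k)) (fun k => hPM _) hpx
  obtain ⟨-, -, -, δ, hδ, hreg⟩ := hpr _ hu
  obtain ⟨h, hhc, hhg⟩ := hps.smoothness
  have hgx : g x = (h x : EReal) := hhg.self_of_nhdsWithin hM.1
  -- Prox-regularity only applies where the value of `g` is close to `g x`; smoothness of `g` along
  -- `M` ensures this at `P (ws k)`.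
  have hhx : ∀ᶠ k in atTop, h (P (ws k)) < h x + δ :=
    (hhc.continuousAt.tendsto.comp hpx).eventually_lt_const (by linarith)
  -- Prox-regularity at `P (ws k)` tested at `ws k`, plus prox optimality at `ws k` tested at `P (ws
  -- k)`, divided by their distance.
  have hkey : ∀ᶠ k in atTop, ⟪us k - γ⁻¹ • (zs k - ws k),
      ‖ws k - P (ws k)‖⁻¹ • (ws k - P (ws k))⟫ ≤ (r / 2 + γ⁻¹ / 2) * ‖ws k - P (ws k)‖ := by
    filter_upwards [hus, hpxM.eventually hhg, hhx, Metric.tendsto_nhds.1 hpx δ hδ,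
      Metric.tendsto_nhds.1 hwsx δ hδ, Metric.tendsto_nhds.1 husx δ hδ]
      with k h1 h2 h3 h4 h5 h6
    obtain ⟨b, hb⟩ := exists_coe_eq_of_mem_proxSet hg (hws k)
    rw [dist_eq_norm] at h4 h5 h6
    have h7 := hreg _ (ws k) _ h1 h4 h5 h6 (by
      rw [h2, hgx, ← EReal.coe_add, EReal.coe_lt_coe_iff]; exact h3)
    rw [h2, hb, ← EReal.coe_add, EReal.coe_le_coe_iff] at h7
    have h8 := le_of_mem_proxSet hγ (hws k) hb h2
    rw [← neg_sub (ws k) (P (ws k)), inner_neg_right, norm_neg] at h8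
    have hpos : 0 < ‖ws k - P (ws k)‖ := norm_pos_iff.2 fun h0 =>
      hsph' k (sub_eq_zero.1 h0 ▸ hPM _)
    rw [real_inner_smul_right, inner_sub_left, inv_mul_le_iff₀ hpos]
    linarith
  have hlhs := (husx.sub ((hzs.sub hwsx).const_smul γ⁻¹)).inner (𝕜 := ℝ) hlim'
  have hrhs : Tendsto (fun k => (r / 2 + γ⁻¹ / 2) * ‖ws k - P (ws k)‖) atTop (𝓝 0) := by
    simpa using (hwsx.sub hpx).norm.const_mul (r / 2 + γ⁻¹ / 2)
  -- The left side tends to `⟪(v + ε • n) - v, n⟫ = ε > 0`, the right side to `0`.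
  have hle := le_of_tendsto_of_tendsto hlhs hrhs hkey
  rw [add_sub_cancel_left, smul_smul, inv_mul_cancel₀ hγ.ne', one_smul, add_sub_cancel_left,
    real_inner_smul_left, real_inner_self_eq_norm_sq, mem_sphere_zero_iff_norm.1 hn] at hle
  linarith

end Identification

/-! ### One-step estimate and contraction threshold. -/

section Convergence

variable {E : Type*} [NormedAddCommGroup E] [InnerProductSpace ℝ E]

/-- Near a structured critical point, a proximal gradient step lands on the manifold, at a
Riemannian distance controlled by the distance of its starting point. -/
theorem IsStructuredCriticalPoint.exists_proxGradient_le [FiniteDimensional ℝ E]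
    {f : E → ℝ} {g : E → EReal} {L : ℝ≥0} (hL : LipschitzWith L (gradient f)) (hg : IsProperFun g)
    {γ r : ℝ} (hγ : 0 < γ) (hr : r < 1 / γ) {M : Set E} {x : E}
    (hx : IsStructuredCriticalPoint r f g M x) :
    ∃ B : ℝ, 0 < B ∧ ∀ U ∈ 𝓝 x, ∀ᶠ y in 𝓝 x, ∀ w ∈ proxSet γ g (y - γ • gradient f y),
      w ∈ U ∧ w ∈ M ∧ riemannianDist M w x ≤ ENNReal.ofReal (B * ‖y - x‖) := by
  have hmin : HasGlobalQuadraticMinorant r g x (-gradient f x) := by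
    refine hasGlobalQuadraticMinorant_of_mem_proxSet hx.pos hg ?_
    rw [smul_neg, ← sub_eq_add_neg, hx.stability]
    exact mem_singleton x
  have hri := mem_intrinsicInterior_of_zero_mem_image_add hx.qualification
  have hident := eventually_proxSet_subset hg hx.partlySmooth hx.proxRegular hri hmin hγ hr
  obtain ⟨p, hM⟩ := hx.partlySmooth.manifold
  obtain ⟨C, hC, hdist⟩ := hM.exists_riemannianDist_le
  have hrγ : 0 < 1 - r * γ := by
    rw [lt_div_iff₀ hγ] at hr; linarith
  -- The stability constant of the prox times a Lipschitz constant of the gradient step.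
  set A : ℝ := 2 / (1 - r * γ) * (1 + γ * L)
  have hA : 0 < A := by positivity
  have hlip : ∀ y, ∀ w ∈ proxSet γ g (y - γ • gradient f y), ‖w - x‖ ≤ A * ‖y - x‖ := by
    intro y w hw
    refine (hmin.norm_prox_sub_le hg hγ hr hw).trans ?_
    rw [mul_assoc]
    refine mul_le_mul_of_nonneg_left ?_ (by positivity)
    have h1 : y - γ • gradient f y - (x + γ • -gradient f x) =
        (y - x) - γ • (gradient f y - gradient f x) := by
      rw [smul_neg, smul_sub]; abel
    have h2 := hL.dist_le_mul y x
    rw [dist_eq_norm, dist_eq_norm] at h2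
    rw [h1]
    refine (norm_sub_le _ _).trans ?_
    rw [norm_smul, Real.norm_of_nonneg hγ.le]
    nlinarith
  refine ⟨C * A, by positivity, fun U hU => ?_⟩
  have hstep : Tendsto (fun y => y - γ • gradient f y) (𝓝 x) (𝓝 (x + γ • -gradient f x)) := by
    have : Continuous fun y => y - γ • gradient f y := by
      have := hL.continuous
      fun_prop
    rw [smul_neg, ← sub_eq_add_neg]
    exact this.tendsto x
  obtain ⟨ρ, hρ, hρU⟩ := Metric.eventually_nhds_iff.1
    ((eventually_nhdsWithin_iff.1 hdist).and hU)
  filter_upwards [hstep.eventually hident, Metric.ball_mem_nhds x (div_pos hρ hA)] with y hy hyρ w hw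
  have hwx := hlip y w hw
  have hwM := hy hw
  obtain ⟨hwd, hwU⟩ := hρU (y := w) (by
    rw [mem_ball_iff_norm, lt_div_iff₀ hA] at hyρ
    rw [dist_eq_norm]
    linarith)
  refine ⟨hwU, hwM, (hwd hwM).trans (ENNReal.ofReal_le_ofReal ?_)⟩
  rw [mul_assoc]
  exact mul_le_mul_of_nonneg_left hwx hC.le

/-- For `e > 0` the left side is `e` times `q B (B e)^θ`, and this factor tends to `0` because `θ >
0`. -/
theorem exists_pos_mul_rpow_le_half {B q θ : ℝ} (hB : 0 < B) (hθ : 0 < θ) :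
    ∃ δ : ℝ, 0 < δ ∧ ∀ e : ℝ, 0 ≤ e → e < δ → q * (B * e) ^ (1 + θ) ≤ e / 2 := by
  have hlim : Tendsto (fun e : ℝ => q * B * (B * e) ^ θ) (𝓝 0) (𝓝 0) := by
    have : ContinuousAt (fun e : ℝ => q * B * (B * e) ^ θ) 0 :=
      continuousAt_const.mul
        ((continuousAt_const.mul continuousAt_id).rpow_const (Or.inr hθ.le))
    simpa [Real.zero_rpow hθ.ne'] using this.tendsto
  obtain ⟨δ, hδ, h⟩ := Metric.eventually_nhds_iff.1
    (hlim.eventually_le_const (show (0 : ℝ) < 1 / 2 by norm_num))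
  refine ⟨δ, hδ, fun e he heδ => ?_⟩
  have := h (y := e) (by rwa [Real.dist_eq, sub_zero, abs_of_nonneg he])
  rcases he.eq_or_lt with rfl | he'
  · simp [Real.zero_rpow (show 1 + θ ≠ 0 by positivity)]
  · rw [Real.rpow_add (mul_pos hB he'), Real.rpow_one]
    nlinarith

end Convergence

/-! ### The main theorem: trapping of the iterates and rate. -/

theorem theorem2 {n : ℕ}
    (f : EuclideanSpace ℝ (Fin n) → ℝ) (g : EuclideanSpace ℝ (Fin n) → EReal) (L : ℝ≥0)
    (hfg : BlanketAssumptions f g L)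
    (γ : ℝ) (hγ : 0 < γ) (hγL : γ * L < 1)
    (ManAcc : Set (EuclideanSpace ℝ (Fin n)) →
      EuclideanSpace ℝ (Fin n) → EuclideanSpace ℝ (Fin n))
    (x y : ℕ → EuclideanSpace ℝ (Fin n)) (N : ℕ → Set (EuclideanSpace ℝ (Fin n)))
    (hrun : IsAlgorithmRun f g γ ManAcc x y N)
    (xbar : EuclideanSpace ℝ (Fin n)) (hlim : MapClusterPt xbar atTop y)
    (M : Set (EuclideanSpace ℝ (Fin n))) (r : ℝ) (hr : r < 1 / γ)
    (hcrit : IsStructuredCriticalPoint r f g M xbar)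
    (hrep : ReportsManifoldNear x N M xbar)
    (θ : ℝ) (hθ : 0 < θ)
    (hrate : HasLocalRate (ManAcc M) M xbar (1 + θ)) :
    ∃ K : ℕ,
      (∀ k ≥ K, x k ∈ M) ∧
      Tendsto x atTop (𝓝 xbar) ∧
      Tendsto (fun k => riemannianDist M (x k) xbar) atTop (𝓝 0) ∧
      (∀ k ≥ K, riemannianDist M (x k) xbar < ⊤) ∧
      ∃ c : ℝ, 0 < c ∧ ∀ k ≥ K,
        riemannianDist M (x (k + 1)) xbar
          ≤ ENNReal.ofReal c * riemannianDist M (x k) xbar ^ (1 + θ) := by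
  obtain ⟨U, hU, hUN⟩ := hrep
  obtain ⟨ε, hε, q, hq, hrate⟩ := hrate
  obtain ⟨B, hB, hprox⟩ := hcrit.exists_proxGradient_le hfg.lipschitz hfg.proper hγ hr
  obtain ⟨δ₁, hδ₁, hprox⟩ := Metric.eventually_nhds_iff.1 (hprox U hU)
  obtain ⟨δ₂, hδ₂, hhalf⟩ := exists_pos_mul_rpow_le_half (q := q) hB hθ
  -- Below `δ`, the prox estimate and the halving both apply, and `B * e < ε` puts the prox point in
  -- the domain of the update's rate.
  obtain ⟨δ, hδ, hδle⟩ : ∃ δ : ℝ, 0 < δ ∧ ∀ e < δ, e < δ₁ ∧ e < δ₂ ∧ B * e < ε := by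
    refine ⟨min (min δ₁ δ₂) (ε / B), by positivity, fun e he => ?_⟩
    simp only [lt_min_iff, lt_div_iff₀ hB] at he
    exact ⟨he.1.1, he.1.2, by linarith⟩
  have hstep : ∀ k, ‖y k - xbar‖ < δ → x (k + 1) ∈ M ∧
      riemannianDist M (x (k + 1)) xbar ≤ ENNReal.ofReal (B * ‖y k - xbar‖) ∧
      riemannianDist M (y (k + 1)) xbar ≤
        ENNReal.ofReal q * riemannianDist M (x (k + 1)) xbar ^ (1 + θ) ∧
      ‖y (k + 1) - xbar‖ ≤ ‖y k - xbar‖ / 2 := by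
    intro k hk
    obtain ⟨h1, h2, h3⟩ := hδle _ hk
    obtain ⟨hxU, hxM, hxd⟩ := hprox (by rwa [dist_eq_norm]) _ (hrun.prox_step k)
    have hy := hrate _ hxM
      (hxd.trans_lt ((ENNReal.ofReal_lt_ofReal_iff hε).2 h3))
    -- `M` is turned into `N (k + 1)` so that the update folds into `y (k + 1)`, then turned back.
    rw [← hUN k hxU hxM, ← hrun.update k, hUN k hxU hxM] at hy
    refine ⟨hxM, hxd, hy, ?_⟩
    rw [← ENNReal.ofReal_le_ofReal_iff (by positivity), ofReal_norm]
    calc ‖y (k + 1) - xbar‖ₑ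
        ≤ ENNReal.ofReal q * riemannianDist M (x (k + 1)) xbar ^ (1 + θ) :=
          (enorm_sub_le_riemannianDist M _ _).trans hy
      _ ≤ ENNReal.ofReal q * ENNReal.ofReal (B * ‖y k - xbar‖) ^ (1 + θ) := by gcongr
      _ = ENNReal.ofReal (q * (B * ‖y k - xbar‖) ^ (1 + θ)) := by
          rw [ENNReal.ofReal_rpow_of_nonneg (by positivity) (by positivity),
            ENNReal.ofReal_mul hq.le]
      _ ≤ ENNReal.ofReal (‖y k - xbar‖ / 2) :=
          ENNReal.ofReal_le_ofReal (hhalf _ (norm_nonneg _) h2)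
  -- The only use of the limit point: one visit to the ball, after which halving traps `y` there.
  obtain ⟨k₀, hk₀⟩ := (hlim.frequently (Metric.ball_mem_nhds xbar hδ)).exists
  rw [dist_eq_norm] at hk₀
  have hgeom : ∀ j, ‖y (j + k₀) - xbar‖ ≤ δ * (1 / 2) ^ j ∧ ‖y (j + k₀) - xbar‖ < δ := by
    intro j
    induction j with
    | zero => simpa using ⟨hk₀.le, hk₀⟩
    | succ j ih =>
      have := (hstep _ ih.2).2.2.2
      rw [add_right_comm, pow_succ]
      constructor <;> linarith [ih.1, ih.2, norm_nonneg (y (j + k₀) - xbar)]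
  have hsmall : ∀ k ≥ k₀, ‖y k - xbar‖ < δ := fun k hk => by
    simpa [Nat.sub_add_cancel hk] using (hgeom (k - k₀)).2
  have hd0 : Tendsto (fun k => riemannianDist M (x k) xbar) atTop (𝓝 0) := by
    rw [← tendsto_add_atTop_iff_nat (k₀ + 1)]
    have hbound : Tendsto (fun j : ℕ => ENNReal.ofReal (B * (δ * (1 / 2) ^ j))) atTop (𝓝 0) := by
      have := ((tendsto_pow_atTop_nhds_zero_of_lt_one (r := (1 / 2 : ℝ)) (by norm_num)
        (by norm_num)).const_mul δ).const_mul B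
      simpa using ENNReal.tendsto_ofReal this
    refine tendsto_of_tendsto_of_tendsto_of_le_of_le tendsto_const_nhds hbound
      (fun _ => zero_le) fun j => ?_
    refine (hstep _ (hgeom j).2).2.1.trans (ENNReal.ofReal_le_ofReal ?_)
    exact mul_le_mul_of_nonneg_left (hgeom j).1 hB.le
  -- The index is shifted by one because `x (k + 1)` is controlled by `y k`. The rate constant `B *
  -- q` composes the update bound with the prox bound.
  refine ⟨k₀ + 1, fun k hk => ?_, ?_, hd0, fun k hk => ?_, B * q, by positivity, fun k hk => ?_⟩
  · obtain ⟨k, rfl⟩ := Nat.exists_eq_add_of_le' (Nat.one_le_of_lt hk)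
    exact (hstep k (hsmall k (by omega))).1
  · rw [tendsto_iff_edist_tendsto_0]
    refine tendsto_of_tendsto_of_tendsto_of_le_of_le tendsto_const_nhds hd0
      (fun _ => zero_le) fun k => ?_
    simpa only [edist_eq_enorm_sub] using enorm_sub_le_riemannianDist M (x k) xbar
  · obtain ⟨k, rfl⟩ := Nat.exists_eq_add_of_le' (Nat.one_le_of_lt hk)
    exact (hstep k (hsmall k (by omega))).2.1.trans_lt ENNReal.ofReal_lt_top
  · obtain ⟨k, rfl⟩ := Nat.exists_eq_add_of_le' (Nat.one_le_of_lt hk)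
    calc riemannianDist M (x (k + 1 + 1)) xbar
        ≤ ENNReal.ofReal B * ‖y (k + 1) - xbar‖ₑ := by
          rw [← ofReal_norm, ← ENNReal.ofReal_mul hB.le]
          exact (hstep (k + 1) (hsmall _ (by omega))).2.1
      _ ≤ ENNReal.ofReal B *
          (ENNReal.ofReal q * riemannianDist M (x (k + 1)) xbar ^ (1 + θ)) := by
          gcongr
          exact (enorm_sub_le_riemannianDist M _ _).trans
            (hstep k (hsmall k (by omega))).2.2.1
      _ = ENNReal.ofReal (B * q) * riemannianDist M (x (k + 1)) xbar ^ (1 + θ) := by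
          rw [ENNReal.ofReal_mul hB.le, mul_assoc]
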